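/- Let $h>0$, let $\mathbb Z_h=\{hn:n\in\mathbb Z\}$, and let $\mathcal G\neq\{0\}$ be a complex Hilbert space with $\dim\mathcal G<\infty$. On the Hilbert space $\ell^2(\mathbb Z_h,\mathcal G)$, with scalar product $\langle\varphi,\phi\rangle=\sum_{n\in\mathbb Z}\langle\varphi(hn),\phi(hn)\rangle_{\mathcal G}$, let $(\partial_h\varphi)(hn)=h^{-2}\big(\varphi(h(n+1))-\varphi(hn)\big)$ and $H_h=-\partial_h-\partial_h^*$, so that $(H_h\varphi)(hn)=h^{-2}\big(2\varphi(hn)-\varphi(h(n+1))-\varphi(h(n-1))\big)$; for $\mathcal G=\mathbb C$ this is the discrete Laplacian $-\Delta_h$. Put $\langle n\rangle=(1+n^2)^{1/2}$. Let $\nu_0>3$ and let $$V_h=\big(\langle(\cdot)h^{-1}\rangle^{-\nu_0/2}\otimes K^*\big)\,\mathscr V_h\,\big(\langle(\cdot)h^{-1}\rangle^{-\nu_0/2}\otimes K\big),$$ where $\mathscr V_h\ge 0$ is a bounded operator on $\ell^2(\mathbb Z_h,\mathcal G)$, $K$ is a Hilbert–Schmidt operator on $\mathcal G$, and $\big((\langle(\cdot)h^{-1}\rangle^{-\nu_0/2}\otimes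 K)\varphi\big)(hn)=\langle n\rangle^{-\nu_0/2}K\varphi(hn)$ (similarly with $K^*$). For a bounded self-adjoint operator $T$ let $\sigma_{\rm disc}(T)$ be the set of isolated points of the spectrum $\sigma(T)$ that are eigenvalues of finite multiplicity, and $\sigma_{\rm ess}(T)=\sigma(T)\setminus\sigma_{\rm disc}(T)$. Then, for each choice of the sign $\pm$: (i) $\sigma_{\rm ess}(H_h\pm V_h)=\sigma_{\rm ess}(H_h)=[0,\tfrac4{h^2}]$; (ii) neither $0$ nor $\tfrac4{h^2}$ is an accumulation point of $\sigma_{\rm disc}(H_h\pm V_h)$, and $\sigma_{\rm disc}(H_h\pm V_h)$ is a finite set. In particular, let $\mathcal G=\mathbb C$, let $V_h\ge 0$ be a bounded operator on $\ell^2(\mathbb Z_h,\mathbb C)$, let $\delta_m$ be the canonical basis vectors, and suppose that there are $\nu_1,\nu_2>3$ and $C\in\mathbb R$ such that $|\langle\delta_n,V_h\delta_m\rangle|\le C\langle n\rangle^{-\nu_1}\langle m\rangle^{-\nu_2}$ for all $n,m\in\mathbb Z$. Then $\sigma_{\rm disc}(-\Delta_h+V_h)$ and $\sigma_{\rm disc}(-\Delta_h-V_h)$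 are finite. -/

import Mathlib

open scoped Topology InnerProductSpace

noncomputable section

namespace DiscreteSchrodinger

/-- The Hilbert space `ℓ²(ℤ_h, G)` over the lattice `ℤ_h = {hn : n ∈ ℤ}`. The lattice point `hn` is
labelled by `n ∈ ℤ`, so that `φ n` stands for the value `φ(hn)`; the scalar product is
`⟪φ, ψ⟫ = ∑ n, ⟪φ(hn), ψ(hn)⟫`. The mesh size `h` enters through the operators below. -/
abbrev L2 (G : Type*) [NormedAddCommGroup G] : Type _ := lp (fun _ : ℤ => G) 2

section Spectra

variable {E : Type*} [NormedAddCommGroup E] [NormedSpace ℂ E]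

/-- The discrete spectrum: the isolated points of the spectrum that are eigenvalues of finite
multiplicity. -/
def discSpectrum (T : E →L[ℂ] E) : Set ℂ :=
  {z | z ∈ spectrum ℂ T ∧ ¬ AccPt z (Filter.principal (spectrum ℂ T)) ∧
    Module.End.HasEigenvalue (T : E →ₗ[ℂ] E) z ∧
    FiniteDimensional ℂ (Module.End.eigenspace (T : E →ₗ[ℂ] E) z)}

/-- The essential spectrum of a (self-adjoint) operator: the part of the spectrum that is not
discrete. -/
def essSpectrum (T : E →L[ℂ] E) : Set ℂ := spectrum ℂ T \ discSpectrum T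

end Spectra

/-- `⟨n⟩ = (1 + n²)^{1/2}`. -/
def bracket (n : ℤ) : ℝ := Real.sqrt (1 + (n : ℝ) ^ 2)

theorem one_le_bracket (n : ℤ) : 1 ≤ bracket n :=
  Real.one_le_sqrt.mpr (by nlinarith [sq_nonneg (n : ℝ)])

variable {G : Type*} [NormedAddCommGroup G] [InnerProductSpace ℂ G]

/-- The shift `(S φ)(hn) = φ(h(n+1))` on `ℓ²(ℤ_h, G)`. -/
def shift : L2 G →L[ℂ] L2 G :=
  LinearMap.mkContinuous
    { toFun := fun φ => ⟨fun n => φ (n + 1), memℓp_gen <| by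
        have h := (lp.memℓp φ).summable (by norm_num)
        exact h.comp_injective (add_left_injective (1 : ℤ))⟩
      map_add' := fun _ _ => by ext; rfl
      map_smul' := fun _ _ => by ext; rfl }
    1
    (fun φ => by
      have h2 : (0 : ℝ) < (2 : ENNReal).toReal := by norm_num
      rw [one_mul]
      refine lp.norm_le_of_tsum_le h2 (norm_nonneg _) ?_
      rw [lp.norm_rpow_eq_tsum h2]
      exact ((Equiv.addRight (1 : ℤ)).tsum_eq
        (fun n => ‖φ n‖ ^ (2 : ENNReal).toReal)).le)

/-- The bounded operator `(∂_h φ)(hn) = h⁻² (φ(h(n+1)) - φ(hn))` on `ℓ²(ℤ_h, G)`. -/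
def finiteDiff (h : ℝ) : L2 G →L[ℂ] L2 G :=
  ((1 / h ^ 2 : ℝ) : ℂ) • (shift - ContinuousLinearMap.id ℂ (L2 G))

/-- The free Hamiltonian `H_h = -∂_h - ∂_h^*` on `ℓ²(ℤ_h, G)`. For `G = ℂ` it is the discrete
Laplacian `-Δ_h`. -/
def freeHamiltonian [CompleteSpace G] (h : ℝ) : L2 G →L[ℂ] L2 G :=
  -finiteDiff h - ContinuousLinearMap.adjoint (finiteDiff h : L2 G →L[ℂ] L2 G)

/-- For `s ≥ 0`, the operator `⟨(·)h⁻¹⟩^{-s} ⊗ K` on `ℓ²(ℤ_h, G) ≅ ℓ²(ℤ_h) ⊗ G`, that is,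
`φ ↦ (hn ↦ ⟨n⟩^{-s} K φ(hn))`. -/
def weightTensor (s : ℝ) (hs : 0 ≤ s) (K : G →L[ℂ] G) : L2 G →L[ℂ] L2 G :=
  lp.mapCLM 2 (fun n : ℤ => ((bracket n ^ (-s) : ℝ) : ℂ) • K) (norm_nonneg K) (fun n => by
    have h0 : 0 ≤ bracket n ^ (-s) := Real.rpow_nonneg (zero_le_one.trans (one_le_bracket n)) _
    have h1 : bracket n ^ (-s) ≤ 1 :=
      Real.rpow_le_one_of_one_le_of_nonpos (one_le_bracket n) (neg_nonpos.mpr hs)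
    rw [norm_smul, Complex.norm_real, Real.norm_of_nonneg h0]
    exact mul_le_of_le_one_left (norm_nonneg K) h1)

/-- `K` is a Hilbert–Schmidt operator on `G`: `∑ ‖K eⱼ‖² < ∞` for an orthonormal basis `(eⱼ)`. -/
def IsHilbertSchmidt (K : G →L[ℂ] G) : Prop :=
  ∃ (s : Set G) (b : HilbertBasis s ℂ G), Summable fun j => ‖K (b j)‖ ^ 2

/-- The standing assumption on the potential:
`V = (⟨(·)h⁻¹⟩^{-ν/2} ⊗ K^*) W (⟨(·)h⁻¹⟩^{-ν/2} ⊗ K)` with `ν > 1`, `W ≥ 0` bounded on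
`ℓ²(ℤ_h, G)` and `K` a Hilbert–Schmidt operator on `G`. -/
def FactorizedPotential [CompleteSpace G] (ν : ℝ) (V : L2 G →L[ℂ] L2 G) : Prop :=
  ∃ (hν : 1 < ν) (W : L2 G →L[ℂ] L2 G) (K : G →L[ℂ] G), W.IsPositive ∧ IsHilbertSchmidt K ∧
    V = weightTensor (ν / 2) (by linarith) (ContinuousLinearMap.adjoint K) ∘L W ∘L
      weightTensor (ν / 2) (by linarith) K

/-- The scalar potential `V ≥ 0` on `ℓ²(ℤ_h)` decays polynomially: its kernel
`v(n,m) = ⟪δ_n, V δ_m⟫ = (V δ_m)(hn)` satisfies `|v(n,m)| ≤ C ⟨n⟩^{-ν₁} ⟨m⟩^{-ν₂}`. -/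
def PolynomiallyDecaying (ν₁ ν₂ : ℝ) (V : L2 ℂ →L[ℂ] L2 ℂ) : Prop :=
  V.IsPositive ∧ ∃ C : ℝ, ∀ n m : ℤ,
    ‖V (lp.single 2 m (1 : ℂ)) n‖ ≤ C * bracket n ^ (-ν₁) * bracket m ^ (-ν₂)

end DiscreteSchrodinger

end

open scoped Topology InnerProductSpace

noncomputable section

/-! All that is needed of `U = ±V` is `HasDecayingForm`: domination by a weight `w` with `∑ w n (1 +
n²) < ∞`. Exponents above 3 give exactly this for `w n = C ⟨n⟩^(-r)`.

Finiteness rests on a crude Hardy bound. If `φ 0 = 0` and `‖ε‖ = 1`, telescoping gives `‖φ n‖ ≤ |n|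
‖Sφ - εφ‖`. With `ε = 1` and `ε = -1`, `h⁻² ‖Sφ - εφ‖²` is the form of `H_h` and of `4/h² - H_h`. If
`φ` also vanishes on a large finite set, the tail of `∑ w n (1 + n²)` is at most `h⁻²`, so the free
form absorbs `U` at both band edges (`exists_finset_abs_re_inner_le`). Hence `0 ≤ H_h + U ≤ 4/h²` on
a subspace of finite codimension, which bounds the number of eigenvalues outside the band
(`finite_eigenvalues_of_form_nonneg`).

Moreover `U` is compact, so outside the band the spectrum consists of eigenvalues (Fredholm
alternative), and truncated plane waves put the whole band into the spectrum. A nondegenerate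
interval has no isolated points, so the discrete spectrum is precisely the part outside the band. -/

namespace DiscreteSchrodinger

/-! ### Abstract spectral theory of bounded symmetric operators -/

section Abstract

variable {E F : Type*} [NormedAddCommGroup E] [InnerProductSpace ℂ E]
  [AddCommGroup F] [Module ℂ F] [FiniteDimensional ℂ F]

open Module.End

/-- If `s (T - a) ≥ 0` on the kernel of a finite-rank map, then `T` has finitely many eigenvalues
`z` with `s (z - a) < 0`. -/
theorem finite_eigenvalues_of_form_nonneg {T : E →ₗ[ℂ] E} (hT : T.IsSymmetric) (π : E →ₗ[ℂ] F)
    (s a : ℝ) (hπ : ∀ φ, π φ = 0 → 0 ≤ s * ((⟪φ, T φ⟫_ℂ).re - a * ‖φ‖ ^ 2)) :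
    {z : ℂ | HasEigenvalue T z ∧ s * (z.re - a) < 0}.Finite := by
  set D := {z : ℂ | HasEigenvalue T z ∧ s * (z.re - a) < 0} with hD
  have hex : ∀ z : D, ∃ v : E, T v = (z : ℂ) • v ∧ ‖v‖ = 1 := fun z => by
    obtain ⟨w, hw, hw0⟩ := z.2.1.exists_hasEigenvector
    refine ⟨((‖w‖⁻¹ : ℝ) : ℂ) • w, ?_, ?_⟩
    · rw [map_smul, mem_eigenspace_iff.1 hw, smul_comm]
    · rw [norm_smul, Complex.norm_real, norm_inv, norm_norm, inv_mul_cancel₀ (norm_ne_zero_iff.2 hw0)]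
  choose v hv hv1 using hex
  have hon : Orthonormal ℂ v := by
    refine ⟨hv1, fun i j hij => ?_⟩
    exact hT.orthogonalFamily_eigenspaces (fun h => hij (Subtype.ext h))
      ⟨v i, mem_eigenspace_iff.2 (hv i)⟩ ⟨v j, mem_eigenspace_iff.2 (hv j)⟩
  -- A vanishing combination of the `π (v z)` lifts to a vector in the kernel of `π`, where the form
  -- is nonnegative. By orthonormality the form there is a sum of nonpositive terms, so each term
  -- vanishes. Thus there are at most `dim F` such eigenvalues.
  have hli : LinearIndependent ℂ (fun z => π (v z)) := by
    rw [linearIndependent_iff']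
    intro t g hg i hi
    have hφ : π (∑ j ∈ t, g j • v j) = 0 := by rw [map_sum, ← hg]; simp
    have h1 := hπ _ hφ
    have h2 : T (∑ j ∈ t, g j • v j) = ∑ j ∈ t, ((j : ℂ) * g j) • v j := by
      rw [map_sum]
      exact Finset.sum_congr rfl fun j _ => by rw [map_smul, hv, smul_smul, mul_comm]
    have h3 : ‖∑ j ∈ t, g j • v j‖ ^ 2 = ∑ j ∈ t, ‖g j‖ ^ 2 := by
      rw [← inner_self_eq_norm_sq (𝕜 := ℂ), hon.inner_sum, map_sum]
      refine Finset.sum_congr rfl fun j _ => ?_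
      rw [RCLike.conj_mul]; norm_cast
    have h4 : (⟪∑ j ∈ t, g j • v j, ∑ j ∈ t, ((j : ℂ) * g j) • v j⟫_ℂ).re
        = ∑ j ∈ t, ‖g j‖ ^ 2 * (j : ℂ).re := by
      rw [hon.inner_sum, Complex.re_sum]
      refine Finset.sum_congr rfl fun j _ => ?_
      rw [mul_left_comm, Complex.conj_mul', mul_comm, ← Complex.ofReal_pow, Complex.re_ofReal_mul]
    rw [h2, h3, h4, Finset.mul_sum, ← Finset.sum_sub_distrib, Finset.mul_sum] at h1
    have h5 : ∀ j ∈ t, s * (‖g j‖ ^ 2 * (j : ℂ).re - a * ‖g j‖ ^ 2) ≤ 0 := fun j _ => by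
      have := mul_nonpos_of_nonneg_of_nonpos (sq_nonneg ‖g j‖) j.2.2.le
      linarith
    have h6 := (Finset.sum_eq_zero_iff_of_nonpos h5).1 (le_antisymm (Finset.sum_nonpos h5) h1) i hi
    have h7 : ‖g i‖ ^ 2 * (s * ((i : ℂ).re - a)) = 0 := by linarith
    simpa [i.2.2.ne] using h7
  exact hli.finite

/-- On the eigenspace the form is `s (z.re - a) ‖v‖²`, negative unless `v = 0`; hence `π` is
injective there. -/
theorem finiteDimensional_eigenspace_of_form_nonneg {T : E →ₗ[ℂ] E} (π : E →ₗ[ℂ] F)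
    (s a : ℝ) (hπ : ∀ φ, π φ = 0 → 0 ≤ s * ((⟪φ, T φ⟫_ℂ).re - a * ‖φ‖ ^ 2))
    {z : ℂ} (hz : s * (z.re - a) < 0) : FiniteDimensional ℂ (eigenspace T z) := by
  refine FiniteDimensional.of_injective (π ∘ₗ (eigenspace T z).subtype) ?_
  rw [← LinearMap.ker_eq_bot, LinearMap.ker_eq_bot']
  rintro ⟨v, hv⟩ h0
  have h1 := hπ v h0
  rw [mem_eigenspace_iff.1 hv, inner_smul_right, inner_self_eq_norm_sq_to_K] at h1
  have h2 : (z * ((‖v‖ : ℝ) : ℂ) ^ 2).re = ‖v‖ ^ 2 * z.re := by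
    rw [mul_comm, ← Complex.ofReal_pow, Complex.re_ofReal_mul]
  have h3 : 0 ≤ ‖v‖ ^ 2 * (s * (z.re - a)) := by
    simp only [Complex.coe_algebraMap] at h1
    rw [h2] at h1
    linarith
  have h4 : ‖v‖ = 0 := by
    by_contra hne
    have : 0 < ‖v‖ ^ 2 := by positivity
    nlinarith
  exact Subtype.ext (norm_eq_zero.1 h4)

/-- A bounded resolvent at `z` would bound `‖φ L‖`. Leaving the vectors unnormalised suits cut-off
waves, whose error stays bounded while their norm grows. -/
theorem mem_spectrum_of_approximate_eigenvectors {T : E →L[ℂ] E} {z : ℂ} {C : ℝ} (φ : ℕ → E)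
    (h1 : ∀ L, ‖T (φ L) - z • φ L‖ ≤ C) (h2 : Filter.Tendsto (fun L => ‖φ L‖) .atTop .atTop) :
    z ∈ spectrum ℂ T := by
  by_contra hz
  obtain ⟨u, hu⟩ := spectrum.notMem_iff.1 hz
  have hb : ∀ L, ‖φ L‖ ≤ ‖(↑u⁻¹ : E →L[ℂ] E)‖ * C := fun L => by
    have h3 : (↑u⁻¹ : E →L[ℂ] E) ((u : E →L[ℂ] E) (φ L)) = φ L := by
      exact congrArg (fun A : E →L[ℂ] E => A (φ L)) u.inv_mul
    have h4 : ‖(u : E →L[ℂ] E) (φ L)‖ ≤ C := by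
      have h5 := h1 L
      rw [hu, Algebra.algebraMap_eq_smul_one]
      rw [norm_sub_rev] at h5
      simpa using h5
    calc ‖φ L‖ = ‖(↑u⁻¹ : E →L[ℂ] E) ((u : E →L[ℂ] E) (φ L))‖ := by rw [h3]
      _ ≤ _ := (ContinuousLinearMap.le_opNorm _ _).trans
        (mul_le_mul_of_nonneg_left h4 (norm_nonneg _))
  obtain ⟨L, hL⟩ := (h2.eventually_gt_atTop (‖(↑u⁻¹ : E →L[ℂ] E)‖ * C)).exists
  exact absurd (hb L) (not_le.2 hL)

/-- Spectral dichotomy: if `[0, c]` lies in the spectrum, everything outside is an eigenvalue and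
`0 ≤ T ≤ c` on the kernel of a finite-rank map, then `[0, c]` is the essential spectrum and the
discrete spectrum is finite. -/
theorem essSpectrum_eq_and_discSpectrum_finite {T : E →L[ℂ] E}
    (hT : (T : E →ₗ[ℂ] E).IsSymmetric) {c : ℝ} (hc : 0 < c)
    (hI : Complex.ofReal '' Set.Icc 0 c ⊆ spectrum ℂ T)
    (hE : ∀ z ∈ spectrum ℂ T, z ∉ Complex.ofReal '' Set.Icc 0 c →
      HasEigenvalue (T : E →ₗ[ℂ] E) z)
    (π : E →ₗ[ℂ] F) (h0 : ∀ φ, π φ = 0 → 0 ≤ (⟪φ, T φ⟫_ℂ).re)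
    (h1 : ∀ φ, π φ = 0 → (⟪φ, T φ⟫_ℂ).re ≤ c * ‖φ‖ ^ 2) :
    essSpectrum T = Complex.ofReal '' Set.Icc 0 c ∧ (discSpectrum T).Finite := by
  have a0 : ∀ φ, π φ = 0 → 0 ≤ (1 : ℝ) * ((⟪φ, T φ⟫_ℂ).re - 0 * ‖φ‖ ^ 2) := fun φ h => by
    simpa using h0 φ h
  have a1 : ∀ φ, π φ = 0 → 0 ≤ (-1 : ℝ) * ((⟪φ, T φ⟫_ℂ).re - c * ‖φ‖ ^ 2) := fun φ h => by
    linarith [h1 φ h]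
  -- Eigenvalues of a symmetric operator are real, so one outside the interval lies strictly below
  -- `0` or strictly above `c`.
  have hside : ∀ z, HasEigenvalue (T : E →ₗ[ℂ] E) z → z ∉ Complex.ofReal '' Set.Icc 0 c →
      1 * (z.re - 0) < 0 ∨ -1 * (z.re - c) < 0 := fun z hz hzI => by
    by_contra! hcon
    exact hzI ⟨z.re, ⟨by linarith [hcon.1], by linarith [hcon.2]⟩,
      Complex.conj_eq_iff_re.1 (hT.conj_eigenvalue_eq_self hz)⟩
  have hfin : (spectrum ℂ T \ Complex.ofReal '' Set.Icc 0 c).Finite := by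
    refine ((finite_eigenvalues_of_form_nonneg hT π 1 0 a0).union
      (finite_eigenvalues_of_form_nonneg hT π (-1) c a1)).subset ?_
    rintro z ⟨hz, hzI⟩
    have he := hE z hz hzI
    exact (hside z he hzI).imp (fun h => ⟨he, h⟩) fun h => ⟨he, h⟩
  have hdisc : discSpectrum T = spectrum ℂ T \ Complex.ofReal '' Set.Icc 0 c := by
    ext z
    constructor
    · rintro ⟨hz, hacc, -, -⟩
      refine ⟨hz, ?_⟩
      rintro ⟨x, hx, rfl⟩
      refine hacc ?_
      -- No point of the interval is isolated, so none can be in the discrete spectrum.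
      have hx' : AccPt x (Filter.principal (Set.Icc 0 c)) :=
        uniqueDiffWithinAt_iff_accPt.1 (uniqueDiffOn_Icc hc x hx)
      have := hx'.map (f := Complex.ofReal) Complex.continuous_ofReal.continuousAt
        Complex.ofReal_injective
      rw [Filter.map_principal] at this
      exact this.mono (Filter.principal_mono.2 hI)
    · rintro ⟨hz, hzI⟩
      have he := hE z hz hzI
      refine ⟨hz, fun hacc => ?_, he, ?_⟩
      -- The spectrum is the union of a closed interval missing `z` and a finite set; neither
      -- accumulates at `z`.
      · rw [← Set.inter_union_sdiff (spectrum ℂ T) (Complex.ofReal '' Set.Icc 0 c),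
          ← Filter.sup_principal, accPt_sup] at hacc
        rcases hacc with h | h
        · have hcl : IsClosed (Complex.ofReal '' Set.Icc 0 c) :=
            (isCompact_Icc.image Complex.continuous_ofReal).isClosed
          exact hzI (isClosed_iff_accPt.1 hcl z (h.mono (Filter.principal_mono.2
            Set.inter_subset_right)))
        · exact Set.Infinite.of_accPt h hfin
      · rcases hside z he hzI with h | h
        · exact finiteDimensional_eigenspace_of_form_nonneg π 1 0 a0 h
        · exact finiteDimensional_eigenspace_of_form_nonneg π (-1) c a1 h
  refine ⟨?_, hdisc ▸ hfin⟩
  rw [essSpectrum, hdisc, Set.sdiff_sdiff_cancel_left hI]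

variable [CompleteSpace E]

/-- With `u = z - H` invertible, `z - H - U = u (1 - u⁻¹ U)`, and the Fredholm alternative applies
to the compact operator `u⁻¹ U` at `1`. -/
theorem hasEigenvalue_of_mem_spectrum_add_compact {H U : E →L[ℂ] E} (hU : IsCompactOperator U)
    {z : ℂ} (hH : z ∉ spectrum ℂ H) (hz : z ∈ spectrum ℂ (H + U)) :
    HasEigenvalue ((H + U : E →L[ℂ] E) : E →ₗ[ℂ] E) z := by
  obtain ⟨u, hu⟩ := spectrum.notMem_iff.1 hH
  set K : E →L[ℂ] E := (↑u⁻¹ : E →L[ℂ] E) * U with hKdef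
  have hK : IsCompactOperator K := hU.clm_comp (↑u⁻¹ : E →L[ℂ] E)
  have hUK : U = u * K := by rw [hKdef, ← mul_assoc, u.mul_inv, one_mul]
  rcases hK.hasEigenvalue_or_mem_resolventSet (one_ne_zero (α := ℂ)) with h | h
  · obtain ⟨x, hx, hx0⟩ := h.exists_hasEigenvector
    have hx1 : K x = x := by simpa using mem_eigenspace_iff.1 hx
    have hx2 : U x = z • x - H x := by
      have : U x = (u : E →L[ℂ] E) (K x) := by
        conv_lhs => rw [hUK]
        rfl
      rw [this, hx1, hu, Algebra.algebraMap_eq_smul_one]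
      simp
    refine hasEigenvalue_of_hasEigenvector (x := x) ⟨mem_eigenspace_iff.2 ?_, hx0⟩
    simp [hx2]
  · refine absurd ?_ hz
    rw [spectrum.mem_resolventSet_iff, map_one] at h
    refine spectrum.mem_resolventSet_iff.2 ?_
    have : algebraMap ℂ (E →L[ℂ] E) z - (H + U) = u * (1 - K) := by
      rw [mul_sub, ← hUK, hu]; simp [sub_sub]
    rw [this]
    exact u.isUnit.mul h

/-- The numerical range lies in `[0, c]`, so `z - H` is coercive. The constant comes from the
imaginary part of `z`, or, for real `z`, from its distance to the interval. -/
theorem notMem_spectrum_of_form_bounds {H : E →L[ℂ] E} (hH : (H : E →ₗ[ℂ] E).IsSymmetric) {c : ℝ}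
    (h0 : ∀ φ, 0 ≤ (⟪φ, H φ⟫_ℂ).re) (hc : ∀ φ, (⟪φ, H φ⟫_ℂ).re ≤ c * ‖φ‖ ^ 2)
    {z : ℂ} (hz : z ∉ Complex.ofReal '' Set.Icc 0 c) : z ∉ spectrum ℂ H := by
  rw [spectrum.notMem_iff]
  suffices ∃ d : ℝ, 0 < d ∧ ∀ φ, ‖φ‖ ^ 2 * d ≤ ‖⟪(algebraMap ℂ (E →L[ℂ] E) z - H) φ, φ⟫_ℂ‖ by
    obtain ⟨d, hd, h⟩ := this
    exact ContinuousLinearMap.isUnit_of_forall_le_norm_inner_map _ (c := ⟨d, hd.le⟩) hd h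
  have hin : ∀ φ, ‖⟪(algebraMap ℂ (E →L[ℂ] E) z - H) φ, φ⟫_ℂ‖
      = ‖((‖φ‖ ^ 2 : ℝ) : ℂ) * z - (((⟪φ, H φ⟫_ℂ).re : ℝ) : ℂ)‖ := fun φ => by
    have hr : (((⟪φ, H φ⟫_ℂ).re : ℝ) : ℂ) = ⟪φ, H φ⟫_ℂ := by
      refine Complex.conj_eq_iff_re.1 ?_
      rw [inner_conj_symm]; exact hH φ φ
    rw [hr, norm_inner_symm, Algebra.algebraMap_eq_smul_one]
    congr 1
    have : ⟪φ, φ⟫_ℂ = ((‖φ‖ ^ 2 : ℝ) : ℂ) := by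
      rw [inner_self_eq_norm_sq_to_K]; push_cast; rfl
    rw [sub_apply, inner_sub_right, smul_apply,
      one_apply_eq_self, inner_smul_right, this, mul_comm]
  have hre : ∀ φ : E, |‖φ‖ ^ 2 * z.re - (⟪φ, H φ⟫_ℂ).re| ≤
      ‖⟪(algebraMap ℂ (E →L[ℂ] E) z - H) φ, φ⟫_ℂ‖ := fun φ => by
    rw [hin]
    refine le_trans (le_of_eq ?_) (Complex.abs_re_le_norm _)
    rw [Complex.sub_re, Complex.re_ofReal_mul, Complex.ofReal_re]
  have him : ∀ φ : E, ‖φ‖ ^ 2 * |z.im| ≤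
      ‖⟪(algebraMap ℂ (E →L[ℂ] E) z - H) φ, φ⟫_ℂ‖ := fun φ => by
    rw [hin]
    refine le_trans (le_of_eq ?_) (Complex.abs_im_le_norm _)
    rw [Complex.sub_im, Complex.im_ofReal_mul, Complex.ofReal_im, sub_zero, abs_mul,
      abs_of_nonneg (sq_nonneg ‖φ‖)]
  by_cases hi : z.im = 0
  · have hzr : z.re < 0 ∨ c < z.re := by
      by_contra! hcon
      exact hz ⟨z.re, hcon, Complex.ext rfl hi.symm⟩
    rcases hzr with hneg | hpos
    · refine ⟨-z.re, by linarith, fun φ => le_trans ?_ (hre φ)⟩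
      exact le_trans (by linarith [h0 φ]) (neg_le_abs _)
    · refine ⟨z.re - c, by linarith, fun φ => le_trans ?_ (hre φ)⟩
      exact le_trans (by linarith [hc φ]) (le_abs_self _)
  · exact ⟨|z.im|, abs_pos.2 hi, him⟩

end Abstract

/-! ### Shift, truncations and plane waves on the lattice -/

section Lattice

variable {G : Type*} [NormedAddCommGroup G]

theorem hasSum_norm_sq (φ : L2 G) : HasSum (fun n => ‖φ n‖ ^ 2) (‖φ‖ ^ 2) := by
  simpa using lp.hasSum_norm (p := 2) (by norm_num) φ

theorem sum_single_apply (s : Finset ℤ) (f : ℤ → G) (m : ℤ) :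
    (∑ n ∈ s, (lp.single 2 n (f n) : L2 G) : L2 G) m = if m ∈ s then f m else 0 := by
  rw [lp.coeFn_sum, Finset.sum_apply]
  simp [lp.single_apply, Pi.single_apply]

variable [InnerProductSpace ℂ G]

@[simp] theorem shift_apply (φ : L2 G) (n : ℤ) : (shift φ : L2 G) n = φ (n + 1) := rfl

theorem norm_shift (φ : L2 G) : ‖(shift φ : L2 G)‖ = ‖φ‖ := by
  have h1 := hasSum_norm_sq (shift φ : L2 G)
  have h2 := (Equiv.addRight (1 : ℤ)).hasSum_iff.2 (hasSum_norm_sq φ)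
  exact (sq_eq_sq₀ (norm_nonneg _) (norm_nonneg _)).1 (h1.unique h2)

theorem shift_single (n : ℤ) (g : G) :
    (shift (lp.single 2 n g : L2 G) : L2 G) = lp.single 2 (n - 1) g := by
  ext m
  by_cases h : m + 1 = n
  · subst h
    rw [shift_apply, lp.single_apply_self, add_sub_cancel_right, lp.single_apply_self]
  · rw [shift_apply, lp.single_apply_ne _ _ _ h, lp.single_apply_ne _ _ _ (by omega)]

/-- The restriction of a function on the lattice to a finite set of lattice points. -/
def truncation (s : Finset ℤ) : L2 G →L[ℂ] L2 G :=
  ∑ n ∈ s, (lp.singleContinuousLinearMap ℂ (fun _ : ℤ => G) 2 n) ∘L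
    (lp.evalCLM ℂ (fun _ : ℤ => G) 2 n)

theorem truncation_eq_sum (s : Finset ℤ) (φ : L2 G) :
    truncation s φ = ∑ n ∈ s, (lp.single 2 n (φ n) : L2 G) := by
  simp [truncation, lp.evalCLM]

theorem truncation_apply (s : Finset ℤ) (φ : L2 G) (m : ℤ) :
    (truncation s φ : L2 G) m = if m ∈ s then φ m else 0 := by
  rw [truncation_eq_sum, sum_single_apply]

theorem isCompactOperator_truncation [FiniteDimensional ℂ G] (s : Finset ℤ) :
    IsCompactOperator (truncation s : L2 G →L[ℂ] L2 G) := by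
  have : ProperSpace G := FiniteDimensional.proper ℂ G
  have hmem : (truncation s : L2 G →L[ℂ] L2 G) ∈
      compactOperator (RingHom.id ℂ) (L2 G) (L2 G) := by
    refine Submodule.sum_mem _ fun n _ => ?_
    have hev : IsCompactOperator (lp.evalCLM ℂ (fun _ : ℤ => G) 2 n) :=
      isCompactOperator_of_locallyCompactSpace_dom (lp.evalCLM ℂ (fun _ : ℤ => G) 2 n)
    exact hev.clm_comp (lp.singleContinuousLinearMap ℂ (fun _ : ℤ => G) 2 n)
  exact hmem

/-- Hardy-type bound: walking from `0` to `n`, each step changes the norm by at most the sup norm of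
`Sφ - εφ`, hence by at most its `ℓ²` norm. The phase `ε` lets one estimate serve both band edges. -/
theorem norm_apply_le_abs_mul {φ : L2 G} (h0 : φ 0 = 0) {ε : ℂ} (hε : ‖ε‖ = 1) (n : ℤ) :
    ‖φ n‖ ≤ |(n : ℝ)| * ‖(shift φ : L2 G) - ε • φ‖ := by
  set d := ‖(shift φ : L2 G) - ε • φ‖
  have hd : ∀ m : ℤ, ‖φ (m + 1) - ε • φ m‖ ≤ d := fun m =>
    lp.norm_apply_le_norm (by norm_num) ((shift φ : L2 G) - ε • φ) m
  have hs : ∀ m : ℤ, ‖ε • φ m‖ = ‖φ m‖ := fun m => by rw [norm_smul, hε, one_mul]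
  induction n with
  | zero => simp [h0]
  | succ k ih =>
    have h1 := norm_le_norm_add_norm_sub' (φ ((k : ℤ) + 1)) (ε • φ k)
    have h2 := hd k
    rw [hs] at h1
    push_cast at ih ⊢
    rw [abs_of_nonneg (by positivity)] at ih ⊢
    linarith
  | pred k ih =>
    have h1 := norm_le_norm_add_norm_sub (φ ((-(k : ℤ) - 1) + 1)) (ε • φ (-(k : ℤ) - 1))
    have h2 := hd (-(k : ℤ) - 1)
    rw [hs] at h1
    rw [sub_add_cancel] at h1 h2
    push_cast at ih ⊢
    rw [abs_neg, abs_of_nonneg (by positivity)] at ih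
    have h3 : |(-(k : ℝ) - 1)| = k + 1 := by
      rw [← abs_neg, abs_of_nonneg (by linarith [(Nat.cast_nonneg k : (0 : ℝ) ≤ k)])]; ring
    rw [h3]
    linarith

/-- The wave `n ↦ zⁿ g` cut off to `0 ≤ n < L`. -/
def truncatedWave (z : ℂ) (g : G) (L : ℕ) : L2 G :=
  ∑ n ∈ (Finset.range L).map Nat.castEmbedding, (lp.single 2 n (z ^ n • g) : L2 G)

theorem truncatedWave_succ (z : ℂ) (g : G) (L : ℕ) :
    truncatedWave z g (L + 1) = truncatedWave z g L + lp.single 2 (L : ℤ) (z ^ L • g) := by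
  simp [truncatedWave, Finset.sum_map, Finset.sum_range_succ]

theorem norm_truncatedWave_sq {z : ℂ} (hz : ‖z‖ = 1) (g : G) (L : ℕ) :
    ‖truncatedWave z g L‖ ^ 2 = L * ‖g‖ ^ 2 := by
  have := lp.norm_sum_single (E := fun _ : ℤ => G) (p := 2) (by norm_num) (fun n => z ^ n • g)
    ((Finset.range L).map Nat.castEmbedding)
  simpa [truncatedWave, norm_smul, hz] using this

theorem norm_truncatedWave_apply_le {z : ℂ} (hz : ‖z‖ = 1) (g : G) (L : ℕ) (n : ℤ) :
    ‖truncatedWave z g L n‖ ≤ ‖g‖ := by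
  rw [truncatedWave, sum_single_apply]
  split_ifs
  · simp [norm_smul, hz]
  · simp

/-- The wave is an exact eigenfunction of the shift away from the cut-offs, so only two boundary
terms survive; at `L = 0` they cancel. -/
theorem shift_truncatedWave (z : ℂ) (g : G) (L : ℕ) :
    (shift (truncatedWave z g L) : L2 G) - z • truncatedWave z g L =
      lp.single 2 (-1 : ℤ) g - lp.single 2 ((L : ℤ) - 1) (z ^ L • g) := by
  induction L with
  | zero => simp [truncatedWave]
  | succ k ih =>
    rw [truncatedWave_succ, map_add, shift_single, smul_add, ← lp.single_smul, smul_smul,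
      ← pow_succ', Nat.cast_succ, add_sub_cancel_right, add_sub_add_comm, ih]
    abel

theorem norm_shift_truncatedWave_le {z : ℂ} (hz : ‖z‖ = 1) (g : G) (L : ℕ) :
    ‖(shift (truncatedWave z g L) : L2 G) - z • truncatedWave z g L‖ ≤ 2 * ‖g‖ := by
  rw [shift_truncatedWave]
  refine (norm_sub_le _ _).trans ?_
  rw [lp.norm_single (by norm_num), lp.norm_single (by norm_num), norm_smul, norm_pow, hz]
  simp [two_mul]

/-! ### The free Hamiltonian and its quadratic form -/

section Free

variable [CompleteSpace G]

theorem adjoint_shift_shift (φ : L2 G) :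
    ContinuousLinearMap.adjoint (shift : L2 G →L[ℂ] L2 G) (shift φ) = φ := by
  have := (ContinuousLinearMap.norm_map_iff_adjoint_comp_self (shift : L2 G →L[ℂ] L2 G)).1 norm_shift
  exact congrArg (fun A : L2 G →L[ℂ] L2 G => A φ) this

theorem norm_adjoint_shift_le (φ : L2 G) :
    ‖ContinuousLinearMap.adjoint (shift : L2 G →L[ℂ] L2 G) φ‖ ≤ ‖φ‖ := by
  refine (ContinuousLinearMap.le_opNorm _ _).trans ?_
  rw [LinearIsometryEquiv.norm_map]
  refine mul_le_of_le_one_left (norm_nonneg _) ?_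
  exact ContinuousLinearMap.opNorm_le_bound _ zero_le_one fun ψ => by rw [norm_shift, one_mul]

theorem freeHamiltonian_apply (h : ℝ) (φ : L2 G) :
    freeHamiltonian h φ = ((1 / h ^ 2 : ℝ) : ℂ) •
      ((2 : ℂ) • φ - shift φ - ContinuousLinearMap.adjoint (shift : L2 G →L[ℂ] L2 G) φ) := by
  have hadj : ContinuousLinearMap.adjoint (finiteDiff h : L2 G →L[ℂ] L2 G) =
      ((1 / h ^ 2 : ℝ) : ℂ) • (ContinuousLinearMap.adjoint (shift : L2 G →L[ℂ] L2 G) -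
        ContinuousLinearMap.id ℂ (L2 G)) := by
    rw [finiteDiff, map_smulₛₗ, map_sub, ContinuousLinearMap.adjoint_id, Complex.conj_ofReal]
  rw [freeHamiltonian, hadj, finiteDiff]
  simp only [sub_apply, neg_apply, smul_apply, ContinuousLinearMap.id_apply]
  module

theorem isSymmetric_freeHamiltonian (h : ℝ) :
    ((freeHamiltonian h : L2 G →L[ℂ] L2 G) : L2 G →ₗ[ℂ] L2 G).IsSymmetric := by
  rw [← ContinuousLinearMap.isSelfAdjoint_iff_isSymmetric, ContinuousLinearMap.isSelfAdjoint_iff',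
    freeHamiltonian, map_sub, map_neg, ContinuousLinearMap.adjoint_adjoint]
  abel

theorem re_inner_freeHamiltonian (h : ℝ) (φ : L2 G) :
    (⟪φ, freeHamiltonian h φ⟫_ℂ).re =
      1 / h ^ 2 * (2 * ‖φ‖ ^ 2 - 2 * (⟪shift φ, φ⟫_ℂ).re) := by
  rw [freeHamiltonian_apply, inner_smul_right, Complex.re_ofReal_mul, inner_sub_right,
    inner_sub_right, inner_smul_right, ContinuousLinearMap.adjoint_inner_right,
    inner_self_eq_norm_sq_to_K, ← inner_conj_symm φ (shift φ)]
  simp only [Complex.sub_re, Complex.conj_re, Complex.coe_algebraMap]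
  have : ((2 : ℂ) * (‖φ‖ : ℂ) ^ 2).re = 2 * ‖φ‖ ^ 2 := by
    norm_cast
  rw [this]; ring

/-- Since the shift is isometric, the form measured from either band edge is a perfect square: `ε =
1` here, `ε = -1` in the companion identity. -/
theorem re_inner_freeHamiltonian_eq_norm_sub (h : ℝ) (φ : L2 G) :
    (⟪φ, freeHamiltonian h φ⟫_ℂ).re = 1 / h ^ 2 * ‖(shift φ : L2 G) - (1 : ℂ) • φ‖ ^ 2 := by
  rw [re_inner_freeHamiltonian, one_smul, @norm_sub_sq ℂ, norm_shift]
  simp only [RCLike.re_eq_complex_re]; ring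

theorem re_inner_freeHamiltonian_eq_sub_norm_add (h : ℝ) (φ : L2 G) :
    (⟪φ, freeHamiltonian h φ⟫_ℂ).re = 4 / h ^ 2 * ‖φ‖ ^ 2 -
      1 / h ^ 2 * ‖(shift φ : L2 G) - (-1 : ℂ) • φ‖ ^ 2 := by
  rw [re_inner_freeHamiltonian, neg_one_smul, sub_neg_eq_add, @norm_add_sq ℂ, norm_shift]
  simp only [RCLike.re_eq_complex_re]; ring

theorem norm_freeHamiltonian_truncatedWave_le {h : ℝ} {z : ℂ} (hz : ‖z‖ = 1)
    (g : G) (L : ℕ) :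
    ‖freeHamiltonian h (truncatedWave z g L) -
      (((1 / h ^ 2 : ℝ) : ℂ) * (2 - z - (starRingEnd ℂ) z)) • truncatedWave z g L‖ ≤
      1 / h ^ 2 * (4 * ‖g‖) := by
  set φ := truncatedWave z g L
  set ψ := (shift φ : L2 G) - z • φ with hψ
  have hzz : (starRingEnd ℂ) z * z = 1 := by rw [Complex.conj_mul', hz]; simp
  -- `S* S = 1` and `|z| = 1` reduce the error for `S*` to that for `S`, so the boundary estimate is
  -- used twice and the adjoint is never computed pointwise.
  have hadj : ContinuousLinearMap.adjoint (shift : L2 G →L[ℂ] L2 G) φ - (starRingEnd ℂ) z • φ =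
      -((starRingEnd ℂ) z • ContinuousLinearMap.adjoint (shift : L2 G →L[ℂ] L2 G) ψ) := by
    rw [hψ, map_sub, map_smul, adjoint_shift_shift, smul_sub, smul_smul, hzz, one_smul]
    abel
  have hdec : freeHamiltonian h φ -
      (((1 / h ^ 2 : ℝ) : ℂ) * (2 - z - (starRingEnd ℂ) z)) • φ =
      -(((1 / h ^ 2 : ℝ) : ℂ) • (ψ + (ContinuousLinearMap.adjoint (shift : L2 G →L[ℂ] L2 G) φ -
        (starRingEnd ℂ) z • φ))) := by
    rw [freeHamiltonian_apply, hψ]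
    module
  have hb := norm_shift_truncatedWave_le hz g L
  rw [hdec, hadj, norm_neg, norm_smul, Complex.norm_real, Real.norm_of_nonneg (by positivity)]
  refine mul_le_mul_of_nonneg_left ?_ (by positivity)
  refine (norm_add_le _ _).trans ?_
  rw [norm_neg, norm_smul, RCLike.norm_conj, hz, one_mul]
  have := norm_adjoint_shift_le ψ
  linarith

end Free

end Lattice

/-! ### Perturbations with a decaying form -/

section Decaying

variable {G : Type*} [NormedAddCommGroup G]

theorem summable_weight_mul_norm_sq {w : ℤ → ℝ} (hw : ∀ n, 0 ≤ w n)
    (hs : Summable fun n : ℤ => w n * (1 + (n : ℝ) ^ 2)) (φ : L2 G) :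
    Summable fun n => w n * ‖φ n‖ ^ 2 := by
  refine Summable.of_nonneg_of_le (fun n => mul_nonneg (hw n) (sq_nonneg _)) (fun n => ?_)
    (hs.mul_right (‖φ‖ ^ 2))
  have h1 : ‖φ n‖ ^ 2 ≤ ‖φ‖ ^ 2 :=
    pow_le_pow_left₀ (norm_nonneg _) (lp.norm_apply_le_norm (by norm_num) φ n) 2
  rw [mul_assoc]
  refine mul_le_mul_of_nonneg_left ?_ (hw n)
  nlinarith [sq_nonneg (n : ℝ), sq_nonneg ‖φ‖, mul_nonneg (sq_nonneg (n : ℝ)) (sq_nonneg ‖φ‖)]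

/-- Used twice: with `M = ‖φ‖²` for compactness, and with `M = ‖Sφ - εφ‖²` for the form bound. -/
theorem tsum_weight_mul_norm_sq_le {w : ℤ → ℝ} (hw : ∀ n, 0 ≤ w n)
    (hs : Summable fun n : ℤ => w n * (1 + (n : ℝ) ^ 2)) (s : Finset ℤ) {φ : L2 G}
    (hφ : ∀ n ∈ s, φ n = 0) {M : ℝ} (hM : ∀ n : ℤ, ‖φ n‖ ^ 2 ≤ (1 + (n : ℝ) ^ 2) * M) :
    ∑' n, w n * ‖φ n‖ ^ 2 ≤ (∑' n : {n // n ∉ s}, w n * (1 + ((n : ℤ) : ℝ) ^ 2)) * M := by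
  have hsupp : Function.support (fun n => w n * ‖φ n‖ ^ 2) ⊆ {n | n ∉ s} := fun n hn hns => by
    simp [hφ n hns] at hn
  have h1 : ∑' n, w n * ‖φ n‖ ^ 2 = ∑' n : {n // n ∉ s}, w n * ‖φ n‖ ^ 2 :=
    (tsum_subtype_eq_of_support_subset hsupp).symm
  rw [h1, ← tsum_mul_right]
  refine Summable.tsum_le_tsum (fun n => ?_) ((summable_weight_mul_norm_sq hw hs φ).subtype _)
    ((hs.subtype _).mul_right M)
  rw [mul_assoc]
  exact mul_le_mul_of_nonneg_left (hM n) (hw n)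

variable [InnerProductSpace ℂ G]

/-- A symmetric operator controlled by multiplication with a weight that has two finite moments. -/
def HasDecayingForm (U : L2 G →L[ℂ] L2 G) : Prop :=
  (U : L2 G →ₗ[ℂ] L2 G).IsSymmetric ∧ ∃ w : ℤ → ℝ, (∀ n, 0 ≤ w n) ∧
    (Summable fun n : ℤ => w n * (1 + (n : ℝ) ^ 2)) ∧
    (∀ φ : L2 G, |(⟪φ, U φ⟫_ℂ).re| ≤ ∑' n, w n * ‖φ n‖ ^ 2) ∧
    ∃ C : ℝ, 0 ≤ C ∧ ∀ φ : L2 G, ‖U φ‖ ^ 2 ≤ C * ∑' n, w n * ‖φ n‖ ^ 2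

theorem HasDecayingForm.neg {U : L2 G →L[ℂ] L2 G} (hU : HasDecayingForm U) :
    HasDecayingForm (-U) := by
  obtain ⟨hsym, w, hw, hs, hf, C, hC, hb⟩ := hU
  refine ⟨fun φ ψ => ?_, w, hw, hs, fun φ => ?_, C, hC, fun φ => ?_⟩
  · have := hsym φ ψ
    simpa [inner_neg_left, inner_neg_right] using this
  · simpa [inner_neg_right] using hf φ
  · simpa using hb φ

theorem hasDecayingForm_zero : HasDecayingForm (0 : L2 G →L[ℂ] L2 G) :=
  ⟨fun φ ψ => by simp, 0, fun _ => le_rfl, by simp, fun φ => by simp, 0, le_rfl,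
    fun φ => by simp⟩

/-- Cutting the input off to a finite set `s` gives compact operators that converge in norm to `U`:
the error is at most `√(C t s)`, with `t s` a tail of a convergent series. -/
theorem HasDecayingForm.isCompactOperator [FiniteDimensional ℂ G] {U : L2 G →L[ℂ] L2 G}
    (hU : HasDecayingForm U) : IsCompactOperator U := by
  have : CompleteSpace G := FiniteDimensional.complete ℂ G
  obtain ⟨-, w, hw, hs, -, C, hC, hb⟩ := hU
  refine isCompactOperator_of_tendsto (l := Filter.atTop)
    (F := fun s : Finset ℤ => U ∘L truncation s) ?_ (.of_forall fun s =>
      (isCompactOperator_truncation s).clm_comp U)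
  rw [tendsto_iff_norm_sub_tendsto_zero]
  set t : Finset ℤ → ℝ := fun s => ∑' n : {n // n ∉ s}, w n * (1 + ((n : ℤ) : ℝ) ^ 2)
  have ht : Filter.Tendsto t .atTop (𝓝 0) :=
    tendsto_tsum_compl_atTop_zero fun n : ℤ => w n * (1 + (n : ℝ) ^ 2)
  have hlim : Filter.Tendsto (fun s => √(C * t s)) .atTop (𝓝 0) := by
    simpa using (ht.const_mul C).sqrt
  refine squeeze_zero (fun _ => norm_nonneg _) (fun s => ?_) hlim
  have ht0 : 0 ≤ t s := tsum_nonneg fun n => mul_nonneg (hw n) (by positivity)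
  refine ContinuousLinearMap.opNorm_le_bound _ (Real.sqrt_nonneg _) fun φ => ?_
  rw [← sq_le_sq₀ (norm_nonneg _) (by positivity), mul_pow, Real.sq_sqrt (by positivity)]
  have h1 : (U ∘L truncation s - U) φ = U (truncation s φ - φ) := by simp
  have h2 : ∀ n, (truncation s φ - φ : L2 G) n = if n ∈ s then 0 else -φ n := fun n => by
    rw [lp.coeFn_sub, Pi.sub_apply, truncation_apply]
    split_ifs <;> simp
  rw [h1, mul_assoc]
  refine (hb _).trans (mul_le_mul_of_nonneg_left ?_ hC)
  refine tsum_weight_mul_norm_sq_le hw hs s (fun n hn => by rw [h2, if_pos hn]) fun n => ?_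
  have h3 : ‖(truncation s φ - φ : L2 G) n‖ ≤ ‖φ‖ := by
    rw [h2]
    split_ifs
    · simp
    · rw [norm_neg]; exact lp.norm_apply_le_norm (by norm_num) φ n
  have h4 := pow_le_pow_left₀ (norm_nonneg _) h3 2
  nlinarith [mul_nonneg (sq_nonneg (n : ℝ)) (sq_nonneg ‖φ‖)]

theorem exists_finset_abs_re_inner_le {h : ℝ} (hh : 0 < h) {U : L2 G →L[ℂ] L2 G}
    (hU : HasDecayingForm U) :
    ∃ s : Finset ℤ, ∀ φ : L2 G, (∀ n ∈ s, φ n = 0) → ∀ ε : ℂ, ‖ε‖ = 1 →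
      |(⟪φ, U φ⟫_ℂ).re| ≤ 1 / h ^ 2 * ‖(shift φ : L2 G) - ε • φ‖ ^ 2 := by
  obtain ⟨-, w, hw, hs, hf, -⟩ := hU
  have ht := tendsto_tsum_compl_atTop_zero fun n : ℤ => w n * (1 + (n : ℝ) ^ 2)
  -- The tail must not exceed the coefficient `1 / h ^ 2` of the free form, and `0 ∈ s` supplies the
  -- starting point of the Hardy bound.
  obtain ⟨s, hs1, hs0⟩ := ((ht.eventually_le_const (show 0 < 1 / h ^ 2 by positivity)).and
    (Filter.eventually_ge_atTop {0})).exists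
  refine ⟨s, fun φ hφ ε hε => (hf φ).trans ?_⟩
  refine (tsum_weight_mul_norm_sq_le hw hs s hφ fun n => ?_).trans
    (mul_le_mul_of_nonneg_right hs1 (sq_nonneg ‖(shift φ : L2 G) - ε • φ‖))
  have h1 := norm_apply_le_abs_mul (hφ 0 (hs0 (Finset.mem_singleton_self 0))) hε n
  have h2 := pow_le_pow_left₀ (norm_nonneg _) h1 2
  rw [mul_pow, sq_abs] at h2
  nlinarith [sq_nonneg ‖(shift φ : L2 G) - ε • φ‖]

/-- Evaluation at the points of a finite set. -/
def evalFinset (s : Finset ℤ) : L2 G →ₗ[ℂ] (s → G) :=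
  LinearMap.pi fun n : s => (lp.evalCLM ℂ (fun _ : ℤ => G) 2 (n : ℤ) : L2 G →ₗ[ℂ] G)

theorem apply_eq_zero_of_evalFinset_eq_zero {s : Finset ℤ} {φ : L2 G} (hφ : evalFinset s φ = 0)
    (n : ℤ) (hn : n ∈ s) : φ n = 0 :=
  congrFun hφ ⟨n, hn⟩

variable [CompleteSpace G]

/-- Plane waves remain approximate eigenvectors under `U`: they are pointwise bounded and `w` is
summable, so `U` contributes an error bounded independently of `L`. -/
theorem Icc_subset_spectrum_add [Nontrivial G] {h : ℝ} (hh : 0 < h) {U : L2 G →L[ℂ] L2 G}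
    (hU : HasDecayingForm U) :
    Complex.ofReal '' Set.Icc 0 (4 / h ^ 2) ⊆ spectrum ℂ (freeHamiltonian h + U) := by
  rintro _ ⟨x, ⟨hx0, hx1⟩, rfl⟩
  obtain ⟨-, w, hw, hs, -, C, hC, hb⟩ := hU
  obtain ⟨g, hg⟩ := exists_ne (0 : G)
  have hh2 : 0 < h ^ 2 := by positivity
  -- Solves the dispersion relation `h⁻² (2 - 2 cos θ) = x`.
  set θ := Real.arccos (1 - x * h ^ 2 / 2) with hθ
  have hcos : Real.cos θ = 1 - x * h ^ 2 / 2 := by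
    rw [le_div_iff₀ hh2] at hx1
    refine Real.cos_arccos ?_ ?_
    · linarith
    · nlinarith
  set z := Complex.exp (θ * Complex.I) with hz_def
  have hz : ‖z‖ = 1 := Complex.norm_exp_ofReal_mul_I θ
  have hzx : ((1 / h ^ 2 : ℝ) : ℂ) * (2 - z - (starRingEnd ℂ) z) = (x : ℂ) := by
    have h1 : z + (starRingEnd ℂ) z = ((2 * Real.cos θ : ℝ) : ℂ) := by
      rw [Complex.add_conj, hz_def, Complex.exp_ofReal_mul_I_re]
    rw [sub_sub, h1, hcos]
    have : (2 : ℂ) = ((2 : ℝ) : ℂ) := by norm_num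
    rw [this, ← Complex.ofReal_sub, ← Complex.ofReal_mul]
    congr 1
    field_simp
    ring
  have hws : Summable w := Summable.of_nonneg_of_le hw
    (fun n => by nlinarith [hw n, mul_nonneg (hw n) (sq_nonneg (n : ℝ))]) hs
  refine mem_spectrum_of_approximate_eigenvectors (truncatedWave z g)
    (C := 1 / h ^ 2 * (4 * ‖g‖) + √(C * ∑' n, w n * ‖g‖ ^ 2)) (fun L => ?_) ?_
  · have h1 := norm_freeHamiltonian_truncatedWave_le (h := h) hz g L
    rw [hzx] at h1
    have h2 : ‖U (truncatedWave z g L)‖ ≤ √(C * ∑' n, w n * ‖g‖ ^ 2) := by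
      refine Real.le_sqrt_of_sq_le ((hb _).trans (mul_le_mul_of_nonneg_left ?_ hC))
      refine Summable.tsum_le_tsum (fun n => ?_) (summable_weight_mul_norm_sq hw hs _)
        (hws.mul_right _)
      exact mul_le_mul_of_nonneg_left
        (pow_le_pow_left₀ (norm_nonneg _) (norm_truncatedWave_apply_le hz g L n) 2) (hw n)
    rw [add_apply, add_sub_right_comm]
    exact (norm_add_le _ _).trans (add_le_add h1 h2)
  · have h1 : ∀ L : ℕ, ‖truncatedWave z g L‖ = √L * ‖g‖ := fun L => by
      rw [← Real.sqrt_sq (norm_nonneg (truncatedWave z g L)), norm_truncatedWave_sq hz,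
        Real.sqrt_mul (Nat.cast_nonneg L), Real.sqrt_sq (norm_nonneg g)]
    simp_rw [h1]
    exact (Real.tendsto_sqrt_atTop.comp tendsto_natCast_atTop_atTop).atTop_mul_const
      (norm_pos_iff.2 hg)

theorem HasDecayingForm.spectrum_add [FiniteDimensional ℂ G] [Nontrivial G] {h : ℝ} (hh : 0 < h)
    {U : L2 G →L[ℂ] L2 G} (hU : HasDecayingForm U) :
    essSpectrum (freeHamiltonian h + U) = Complex.ofReal '' Set.Icc 0 (4 / h ^ 2) ∧
      (discSpectrum (freeHamiltonian h + U)).Finite := by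
  obtain ⟨s, hs⟩ := exists_finset_abs_re_inner_le hh hU
  have hadd : ∀ φ : L2 G, (⟪φ, (freeHamiltonian h + U : L2 G →L[ℂ] L2 G) φ⟫_ℂ).re =
      (⟪φ, freeHamiltonian h φ⟫_ℂ).re + (⟪φ, U φ⟫_ℂ).re := fun φ => by
    rw [add_apply, inner_add_right, Complex.add_re]
  refine essSpectrum_eq_and_discSpectrum_finite ?_ (by positivity)
    (Icc_subset_spectrum_add hh hU) (fun z hz hzI => ?_)
    (evalFinset s) (fun φ hφ => ?_) (fun φ hφ => ?_)
  · exact (isSymmetric_freeHamiltonian h).add hU.1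
  · refine hasEigenvalue_of_mem_spectrum_add_compact hU.isCompactOperator ?_ hz
    refine notMem_spectrum_of_form_bounds (isSymmetric_freeHamiltonian h) (fun φ => ?_)
      (fun φ => ?_) hzI
    · rw [re_inner_freeHamiltonian_eq_norm_sub]; positivity
    · rw [re_inner_freeHamiltonian_eq_sub_norm_add, sub_le_self_iff]; positivity
  · have h1 := (abs_le.1 (hs φ (apply_eq_zero_of_evalFinset_eq_zero hφ) 1 (by simp))).1
    rw [hadd, re_inner_freeHamiltonian_eq_norm_sub]
    linarith
  · have h1 := (abs_le.1 (hs φ (apply_eq_zero_of_evalFinset_eq_zero hφ) (-1) (by simp))).2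
    rw [hadd, re_inner_freeHamiltonian_eq_sub_norm_add]
    linarith

end Decaying

/-! ### Summability of powers of the bracket -/

theorem bracket_pos (n : ℤ) : 0 < bracket n := zero_lt_one.trans_le (one_le_bracket n)

theorem bracket_sq (n : ℤ) : bracket n ^ 2 = 1 + (n : ℝ) ^ 2 := Real.sq_sqrt (by positivity)

theorem summable_bracket_rpow_neg {r : ℝ} (hr : 1 < r) : Summable fun n => bracket n ^ (-r) := by
  refine (Real.summable_abs_int_rpow hr).of_norm_bounded_eventually ?_
  rw [Filter.eventually_cofinite]
  -- At `n = 0` the comparison fails because `0 ^ (-r)` is `0` by convention; one exceptional point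
  -- is harmless.
  refine (Set.finite_singleton (0 : ℤ)).subset fun n hn => ?_
  by_contra h0
  refine hn ?_
  have hpos : 0 < |(n : ℝ)| := abs_pos.2 (Int.cast_ne_zero.2 h0)
  rw [Real.norm_of_nonneg (Real.rpow_nonneg (bracket_pos n).le _)]
  refine Real.rpow_le_rpow_of_nonpos hpos ?_ (by linarith)
  exact Real.abs_le_sqrt (by linarith)

/-- The factor `1 + n² = ⟨n⟩²` costs two powers, which is where the threshold 3 comes from. -/
theorem summable_bracket_rpow_neg_mul {r : ℝ} (hr : 3 < r) :
    Summable fun n : ℤ => bracket n ^ (-r) * (1 + (n : ℝ) ^ 2) := by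
  refine (summable_bracket_rpow_neg (r := r - 2) (by linarith)).congr fun n => ?_
  rw [← bracket_sq, ← Real.rpow_natCast (bracket n) 2, ← Real.rpow_add (bracket_pos n)]
  congr 1
  push_cast
  ring

/-! ### The two classes of potentials have decaying forms -/

section Potentials

variable {G : Type*} [NormedAddCommGroup G] [InnerProductSpace ℂ G]

theorem weightTensor_apply {s : ℝ} (hs : 0 ≤ s) (K : G →L[ℂ] G) (φ : L2 G) (n : ℤ) :
    (weightTensor s hs K φ : L2 G) n = ((bracket n ^ (-s) : ℝ) : ℂ) • K (φ n) := rfl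

variable [CompleteSpace G]

/-- Write `V = R* R`; then `‖V φ‖ ≤ ‖R‖ ‖R φ‖` and `‖R φ‖²` is the form. Thus for positive `V` a
form bound alone yields the operator bound in `HasDecayingForm`. -/
theorem _root_.ContinuousLinearMap.IsPositive.exists_norm_sq_le {E : Type*} [NormedAddCommGroup E]
    [InnerProductSpace ℂ E] [CompleteSpace E] {V : E →L[ℂ] E} (hV : V.IsPositive) :
    ∃ C : ℝ, 0 ≤ C ∧ ∀ φ, ‖V φ‖ ^ 2 ≤ C * (⟪φ, V φ⟫_ℂ).re := by
  obtain ⟨R, hR⟩ := CStarAlgebra.nonneg_iff_eq_star_mul_self.1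
    ((ContinuousLinearMap.nonneg_iff_isPositive V).2 hV)
  have happ : ∀ φ, V φ = ContinuousLinearMap.adjoint R (R φ) := fun φ =>
    congrArg (fun A : E →L[ℂ] E => A φ) hR
  refine ⟨‖R‖ ^ 2, sq_nonneg _, fun φ => ?_⟩
  have h1 : (⟪φ, V φ⟫_ℂ).re = ‖R φ‖ ^ 2 := by
    rw [happ, ContinuousLinearMap.adjoint_inner_right]
    exact inner_self_eq_norm_sq (𝕜 := ℂ) (R φ)
  have h2 : ‖V φ‖ ≤ ‖R‖ * ‖R φ‖ := by
    rw [happ, ← LinearIsometryEquiv.norm_map ContinuousLinearMap.adjoint R]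
    exact ContinuousLinearMap.le_opNorm _ _
  rw [h1, ← mul_pow]
  exact pow_le_pow_left₀ (norm_nonneg _) h2 2

theorem hasDecayingForm_of_isPositive {V : L2 G →L[ℂ] L2 G} (hV : V.IsPositive) {C r : ℝ}
    (hC : 0 ≤ C) (hr : 3 < r)
    (hf : ∀ φ : L2 G, (⟪φ, V φ⟫_ℂ).re ≤ ∑' n, C * bracket n ^ (-r) * ‖φ n‖ ^ 2) :
    HasDecayingForm V := by
  obtain ⟨D, hD, hb⟩ := hV.exists_norm_sq_le
  refine ⟨hV.isSymmetric, fun n => C * bracket n ^ (-r),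
    fun n => mul_nonneg hC (Real.rpow_nonneg (bracket_pos n).le _), ?_, fun φ => ?_, D, hD,
    fun φ => (hb φ).trans (mul_le_mul_of_nonneg_left (hf φ) hD)⟩
  · simpa only [mul_assoc] using (summable_bracket_rpow_neg_mul hr).mul_left C
  · exact (abs_of_nonneg (hV.re_inner_nonneg_right φ)).trans_le (hf φ)

theorem weightTensor_adjoint {s : ℝ} (hs : 0 ≤ s) (K : G →L[ℂ] G) :
    weightTensor s hs (ContinuousLinearMap.adjoint K) =
      ContinuousLinearMap.adjoint (weightTensor s hs K) := by
  rw [ContinuousLinearMap.eq_adjoint_iff]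
  intro φ ψ
  rw [lp.inner_eq_tsum, lp.inner_eq_tsum]
  refine tsum_congr fun n => ?_
  rw [weightTensor_apply, weightTensor_apply, inner_smul_left, inner_smul_right,
    Complex.conj_ofReal, ContinuousLinearMap.adjoint_inner_left]

theorem FactorizedPotential.hasDecayingForm {ν : ℝ} (hν : 3 < ν) {V : L2 G →L[ℂ] L2 G}
    (hV : FactorizedPotential ν V) : HasDecayingForm V := by
  obtain ⟨h1, W, K, hW, -, rfl⟩ := hV
  rw [weightTensor_adjoint]
  set B := weightTensor (ν / 2) (by linarith) K with hB
  refine hasDecayingForm_of_isPositive (hW.adjoint_conj B) (C := ‖W‖ * ‖K‖ ^ 2) (by positivity) hν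
    fun φ => ?_
  -- The potential is `B* W B`, so its form is controlled by `‖B φ‖²`; squaring the half-power
  -- weight in `B` gives `⟨n⟩^(-ν)`.
  have hin : (⟪φ, (ContinuousLinearMap.adjoint B ∘L W ∘L B) φ⟫_ℂ).re ≤ ‖W‖ * ‖B φ‖ ^ 2 := by
    rw [ContinuousLinearMap.comp_apply, ContinuousLinearMap.adjoint_inner_right]
    refine (Complex.re_le_norm _).trans ((norm_inner_le_norm _ _).trans ?_)
    have := W.le_opNorm (B φ)
    rw [ContinuousLinearMap.comp_apply]
    nlinarith [norm_nonneg (B φ)]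
  refine hin.trans ?_
  rw [← (hasSum_norm_sq (B φ)).tsum_eq, ← tsum_mul_left]
  refine Summable.tsum_le_tsum (fun n => ?_) ((hasSum_norm_sq (B φ)).summable.mul_left _)
    (summable_weight_mul_norm_sq (w := fun n => ‖W‖ * ‖K‖ ^ 2 * bracket n ^ (-ν))
      (fun n => mul_nonneg (by positivity)
      (Real.rpow_nonneg (bracket_pos n).le _)) ?_ φ)
  · have h2 : ‖(B φ : L2 G) n‖ ^ 2 ≤ bracket n ^ (-ν) * (‖K‖ * ‖φ n‖) ^ 2 := by
      rw [hB, weightTensor_apply, norm_smul, Complex.norm_real,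
        Real.norm_of_nonneg (Real.rpow_nonneg (bracket_pos n).le _), mul_pow,
        ← Real.rpow_natCast (bracket n ^ _) 2, ← Real.rpow_mul (bracket_pos n).le]
      have : -(ν / 2) * ((2 : ℕ) : ℝ) = -ν := by push_cast; ring
      rw [this]
      exact mul_le_mul_of_nonneg_left (pow_le_pow_left₀ (norm_nonneg _) (K.le_opNorm _) 2)
        (Real.rpow_nonneg (bracket_pos n).le _)
    refine (mul_le_mul_of_nonneg_left h2 (norm_nonneg W)).trans (le_of_eq ?_)
    ring
  · exact ((summable_bracket_rpow_neg_mul hν).mul_left (‖W‖ * ‖K‖ ^ 2)).congr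
      fun n => (mul_assoc _ _ _).symm

/-- With `r = min ν₁ ν₂` the kernel is dominated by the rank-one kernel `C b n b m`. The form is
then at most `C (∑ b ‖φ‖)²`, and Cauchy–Schwarz gives `C (∑ b) ∑ b ‖φ‖²`. -/
theorem PolynomiallyDecaying.hasDecayingForm {ν₁ ν₂ : ℝ} (h₁ : 3 < ν₁) (h₂ : 3 < ν₂)
    {V : L2 ℂ →L[ℂ] L2 ℂ} (hV : PolynomiallyDecaying ν₁ ν₂ V) : HasDecayingForm V := by
  obtain ⟨hpos, C, hC⟩ := hV
  set r := min ν₁ ν₂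
  have hr : 3 < r := lt_min h₁ h₂
  set b : ℤ → ℝ := fun n => bracket n ^ (-r)
  have hb : ∀ n, 0 ≤ b n := fun n => Real.rpow_nonneg (bracket_pos n).le _
  have hC0 : 0 ≤ C := by
    have := (norm_nonneg _).trans (hC 0 0)
    simpa [bracket] using this
  have hker : ∀ n m, ‖V (lp.single 2 m (1 : ℂ)) n‖ ≤ C * b n * b m := fun n m => by
    refine (hC n m).trans ?_
    have hn : bracket n ^ (-ν₁) ≤ b n :=
      Real.rpow_le_rpow_of_exponent_le (one_le_bracket n) (neg_le_neg (min_le_left _ _))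
    have hm : bracket m ^ (-ν₂) ≤ b m :=
      Real.rpow_le_rpow_of_exponent_le (one_le_bracket m) (neg_le_neg (min_le_right _ _))
    exact mul_le_mul (mul_le_mul_of_nonneg_left hn hC0) hm
      (Real.rpow_nonneg (bracket_pos m).le _) (mul_nonneg hC0 (hb n))
  have hbs : Summable b := summable_bracket_rpow_neg (by linarith)
  set S := ∑' n, b n
  refine hasDecayingForm_of_isPositive hpos (C := C * S) (mul_nonneg hC0 (tsum_nonneg hb)) hr
    fun φ => ?_
  have hsum : Summable fun n => C * S * b n * ‖φ n‖ ^ 2 := by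
    refine summable_weight_mul_norm_sq
      (fun n => mul_nonneg (mul_nonneg hC0 (tsum_nonneg hb)) (hb n)) ?_ φ
    simpa only [mul_assoc] using (summable_bracket_rpow_neg_mul hr).mul_left (C * S)
  -- The kernel estimate is proved for finitely supported truncations and passed to the limit by
  -- continuity of the form.
  have hlim : Filter.Tendsto (fun s : Finset ℤ => ∑ n ∈ s, (lp.single 2 n (φ n) : L2 ℂ))
      .atTop (𝓝 φ) := lp.hasSum_single (by norm_num) φ
  have hlim2 := Complex.continuous_re.tendsto _ |>.comp
    (hlim.inner ((V.continuous.tendsto φ).comp hlim) (𝕜 := ℂ))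
  refine le_of_tendsto hlim2 (.of_forall fun s => ?_)
  have hV1 : ∀ m, V (lp.single 2 m (φ m)) = φ m • V (lp.single 2 m (1 : ℂ)) := fun m => by
    rw [← map_smul, ← lp.single_smul, smul_eq_mul, mul_one]
  calc (⟪∑ n ∈ s, (lp.single 2 n (φ n) : L2 ℂ), V (∑ m ∈ s, (lp.single 2 m (φ m) : L2 ℂ))⟫_ℂ).re
      ≤ ‖∑ n ∈ s, ∑ m ∈ s, ⟪φ n, φ m * V (lp.single 2 m (1 : ℂ)) n⟫_ℂ‖ := by
        refine (Complex.re_le_norm _).trans (le_of_eq ?_)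
        rw [map_sum, sum_inner]
        congr 1
        refine Finset.sum_congr rfl fun n _ => ?_
        rw [inner_sum]
        refine Finset.sum_congr rfl fun m _ => ?_
        rw [lp.inner_single_left, hV1]
        rfl
    _ ≤ ∑ n ∈ s, ∑ m ∈ s, C * (b n * ‖φ n‖) * (b m * ‖φ m‖) := by
        refine (norm_sum_le _ _).trans (Finset.sum_le_sum fun n _ => ?_)
        refine (norm_sum_le _ _).trans (Finset.sum_le_sum fun m _ => ?_)
        refine (norm_inner_le_norm _ _).trans ?_
        rw [norm_mul]
        have := mul_le_mul_of_nonneg_left (hker n m)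
          (mul_nonneg (norm_nonneg (φ n)) (norm_nonneg (φ m)))
        linarith
    _ = C * (∑ n ∈ s, b n * ‖φ n‖) ^ 2 := by
        rw [sq, Finset.sum_mul_sum, Finset.mul_sum]
        simp_rw [Finset.mul_sum, mul_assoc]
    _ ≤ C * ((∑ n ∈ s, b n) * ∑ n ∈ s, b n * ‖φ n‖ ^ 2) := by
        refine mul_le_mul_of_nonneg_left ?_ hC0
        refine Finset.sum_sq_le_sum_mul_sum_of_sq_le_mul s (fun n _ => hb n)
          (fun n _ => mul_nonneg (hb n) (sq_nonneg _)) fun n _ => le_of_eq ?_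
        ring
    _ ≤ C * (S * ∑ n ∈ s, b n * ‖φ n‖ ^ 2) :=
        mul_le_mul_of_nonneg_left (mul_le_mul_of_nonneg_right
          (hbs.sum_le_tsum s fun n _ => hb n)
          (Finset.sum_nonneg fun n _ => mul_nonneg (hb n) (sq_nonneg _))) hC0
    _ = ∑ n ∈ s, C * S * b n * ‖φ n‖ ^ 2 := by
        simp_rw [Finset.mul_sum, mul_assoc]
    _ ≤ _ := hsum.sum_le_tsum s fun n _ =>
        mul_nonneg (mul_nonneg (mul_nonneg hC0 (tsum_nonneg hb)) (hb n)) (sq_nonneg _)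

end Potentials

end DiscreteSchrodinger

end

/-! ### Assembly of the theorem -/

theorem corollary5p6 (h : ℝ) (hh : 0 < h) :
    (∀ (G : Type*) [NormedAddCommGroup G] [InnerProductSpace ℂ G] [CompleteSpace G]
        [FiniteDimensional ℂ G] [Nontrivial G] (ν₀ : ℝ), 3 < ν₀ →
      ∀ V : DiscreteSchrodinger.L2 G →L[ℂ] DiscreteSchrodinger.L2 G,
        DiscreteSchrodinger.FactorizedPotential ν₀ V →
      ∀ T ∈ ({DiscreteSchrodinger.freeHamiltonian h + V,
              DiscreteSchrodinger.freeHamiltonian h - V} :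
            Set (DiscreteSchrodinger.L2 G →L[ℂ] DiscreteSchrodinger.L2 G)),
        DiscreteSchrodinger.essSpectrum T =
            DiscreteSchrodinger.essSpectrum
              (DiscreteSchrodinger.freeHamiltonian h :
                DiscreteSchrodinger.L2 G →L[ℂ] DiscreteSchrodinger.L2 G) ∧
        DiscreteSchrodinger.essSpectrum T = Complex.ofReal '' Set.Icc 0 (4 / h ^ 2) ∧
        (∀ z ∈ ({0, 4 / h ^ 2} : Set ℝ),
          ¬ AccPt (z : ℂ) (Filter.principal (DiscreteSchrodinger.discSpectrum T))) ∧
        (DiscreteSchrodinger.discSpectrum T).Finite) ∧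
    (∀ (ν₁ ν₂ : ℝ), 3 < ν₁ → 3 < ν₂ →
      ∀ V : DiscreteSchrodinger.L2 ℂ →L[ℂ] DiscreteSchrodinger.L2 ℂ,
        DiscreteSchrodinger.PolynomiallyDecaying ν₁ ν₂ V →
        (DiscreteSchrodinger.discSpectrum
          (DiscreteSchrodinger.freeHamiltonian h + V)).Finite ∧
        (DiscreteSchrodinger.discSpectrum
          (DiscreteSchrodinger.freeHamiltonian h - V)).Finite) := by
  constructor
  · intro G _ _ _ _ _ ν₀ hν V hV T hT
    have hVd := hV.hasDecayingForm hν
    -- The zero perturbation gives the essential spectrum of the free operator itself.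
    have h0 := (DiscreteSchrodinger.hasDecayingForm_zero (G := G)).spectrum_add hh
    rw [add_zero] at h0
    have key : DiscreteSchrodinger.essSpectrum T = Complex.ofReal '' Set.Icc 0 (4 / h ^ 2) ∧
        (DiscreteSchrodinger.discSpectrum T).Finite := by
      rcases hT with rfl | rfl
      · exact hVd.spectrum_add hh
      · rw [sub_eq_add_neg]
        exact hVd.neg.spectrum_add hh
    exact ⟨key.1.trans h0.1.symm, key.1, fun z _ hacc => Set.Infinite.of_accPt hacc key.2, key.2⟩
  · intro ν₁ ν₂ h₁ h₂ V hV
    have hVd := hV.hasDecayingForm h₁ h₂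
    refine ⟨(hVd.spectrum_add hh).2, ?_⟩
    rw [sub_eq_add_neg]
    exact (hVd.neg.spectrum_add hh).2
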